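/- Work over $\mathbb{C}$. An FGCCHA is a graded Hopf algebra $H=\bigoplus_{n\ge 0}H_n$ (all structure maps preserve degree) that is cocommutative, $\Delta=\tau\circ\Delta$ with $\tau(x\otimes y)=y\otimes x$, and is freely generated as a unital associative algebra by some graded subset $X=\biguplus_{n\ge1}X^{(n)}$ with $X^{(n)}\subseteq H_n$. Homomorphisms of FGCCHAs are degree-preserving Hopf algebra homomorphisms. For a sequence $\vec a=(a_n)_{n\ge1}$ of nonnegative integers, let $\operatorname{OPG}_{\vec a}(H)$ be the set of ordered primitive generating sets of $H$ of graded cardinality $\vec a$, i.e. of sequences $\vec A=\big((\alpha^{(n)}_1,\dots,\alpha^{(n)}_{a_n})\big)_{n\ge1}$ of tuples of elements $\alpha_i^{(n)}\in H_n$ that are primitive ($\Delta(x)=x\otimes1+1\otimes x$) and together freely generate $H$ as an algebra. For $\vec A\in\operatorname{OPG}_{\vec a}(H)$ and $\vec B=\big((\beta^{(n)}_1,\dots,\beta^{(n)}_{b_n})\big)_{n\ge1}\in\operatorname{OPG}_{\vec b}(K)$, let $f^{\vec A}_{\vec B}:H\to K$ be the algebra homomorphism with $\alpha_i^{(n)}\mapsto\beta_i^{(n)}$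 if $i\le b_n$ and $\alpha^{(n)}_i\mapsto 0$ otherwise. Theorem. Let $H$ and $K$ be FGCCHAs which are freely generated as algebras by graded sets $X$ and $Y$ as above, with finite graded cardinalities $|X^{(n)}|=a_n$ and $|Y^{(n)}|=b_n$ for all $n\ge1$. (1) There is a surjective homomorphism $f:H\to K$ if and only if $a_n\ge b_n$ for all $n\ge1$. (2) For every surjective homomorphism $f:H\to K$ there exist $\vec A\in\operatorname{OPG}_{\vec a}(H)$ and $\vec B\in\operatorname{OPG}_{\vec b}(K)$ with $f=f^{\vec A}_{\vec B}$. Moreover, if $\vec a\ne\vec 0$, then such a pair $(\vec A,\vec B)$ is not unique. -/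

import Mathlib

open scoped TensorProduct

noncomputable section

namespace FGCCHA

universe u v

section Basic

variable {H : Type u} [Ring H] [HopfAlgebra ℂ H]

/-- The degree `n` part `⨁_{i + j = n} H_i ⊗ H_j` of `H ⊗ H`. -/
def tensorDegree (𝒜 : ℕ → Submodule ℂ H) (n : ℕ) : Submodule ℂ (H ⊗[ℂ] H) :=
  ⨆ p ∈ Finset.HasAntidiagonal.antidiagonal n,
    LinearMap.range (TensorProduct.map (𝒜 p.1).subtype (𝒜 p.2).subtype)

/-- A Hopf algebra with an algebra grading is a graded Hopf algebra when the comultiplication, the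
counit (to `ℂ` concentrated in degree `0`) and the antipode are homogeneous of degree `0`. -/
structure IsGradedHopf (𝒜 : ℕ → Submodule ℂ H) [GradedAlgebra 𝒜] : Prop where
  comul_mem : ∀ n, ∀ x ∈ 𝒜 n, Coalgebra.comul (R := ℂ) x ∈ tensorDegree 𝒜 n
  counit_eq_zero : ∀ n, n ≠ 0 → ∀ x ∈ 𝒜 n, Coalgebra.counit (R := ℂ) x = 0
  antipode_mem : ∀ n, ∀ x ∈ 𝒜 n, HopfAlgebra.antipode ℂ x ∈ 𝒜 n

/-- The family `x` freely generates `H` as a unital associative algebra. -/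
abbrev IsFreeFamily {ι : Type*} (x : ι → H) : Prop :=
  Function.Bijective (FreeAlgebra.lift ℂ x)

/-- `H` is freely generated, as an algebra, by the graded subset `X = ⨄_{n ≥ 1} X n`,
where `X n` consists of elements of degree `n`. -/
structure FreelyGenerates (𝒜 : ℕ → Submodule ℂ H) (X : ℕ+ → Set H) : Prop where
  subset : ∀ n : ℕ+, X n ⊆ 𝒜 n
  free : IsFreeFamily (fun x : Σ n : ℕ+, X n => (x.2 : H))

/-- Free graded connected cocommutative Hopf algebras over `ℂ`. Connectedness is a consequence of
freeness on generators of positive degree. -/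
structure IsFGCCHA (𝒜 : ℕ → Submodule ℂ H) [GradedAlgebra 𝒜] : Prop where
  graded : IsGradedHopf 𝒜
  cocomm : Coalgebra.IsCocomm ℂ H
  free : ∃ X : ℕ+ → Set H, FreelyGenerates 𝒜 X

/-- Primitive elements: `Δ x = x ⊗ 1 + 1 ⊗ x`. -/
def IsPrimitiveElement (x : H) : Prop :=
  Coalgebra.comul (R := ℂ) x = x ⊗ₜ[ℂ] (1 : H) + (1 : H) ⊗ₜ[ℂ] x

/-- Ordered primitive generating sets with `a n` elements in degree `n`: sequences of tuples of
homogeneous primitive elements which together freely generate `H`. -/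
@[ext]
structure OPG (𝒜 : ℕ → Submodule ℂ H) (a : ℕ+ → ℕ) where
  elem : (n : ℕ+) → Fin (a n) → H
  mem : ∀ (n : ℕ+) (i : Fin (a n)), elem n i ∈ 𝒜 n
  primitive : ∀ (n : ℕ+) (i : Fin (a n)), IsPrimitiveElement (elem n i)
  free : IsFreeFamily (fun x : Σ n : ℕ+, Fin (a n) => elem x.1 x.2)

end Basic

section Maps

variable {H : Type u} [Ring H] [HopfAlgebra ℂ H] {K : Type v} [Ring K] [HopfAlgebra ℂ K]
variable {𝒜 : ℕ → Submodule ℂ H} {ℬ : ℕ → Submodule ℂ K} {a b : ℕ+ → ℕ}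

/-- Homomorphisms of graded Hopf algebras: degree preserving bialgebra homomorphisms
(these commute with the antipodes automatically). -/
structure GradedHopfHom (𝒜 : ℕ → Submodule ℂ H) (ℬ : ℕ → Submodule ℂ K)
    extends H →ₐc[ℂ] K where
  map_mem : ∀ n, ∀ x ∈ 𝒜 n, toBialgHom x ∈ ℬ n

/-- The coordinate projection `f^A_B : H → K`: the algebra homomorphism sending the `i`-th element
of degree `n` of `A` to the `i`-th element of degree `n` of `B` if there is one, and to `0`
otherwise. -/
def projection (A : OPG 𝒜 a) (B : OPG ℬ b) : H →ₐ[ℂ] K :=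
  (FreeAlgebra.lift ℂ (fun x : Σ n : ℕ+, Fin (a n) =>
    if h : (x.2 : ℕ) < b x.1 then B.elem x.1 ⟨x.2, h⟩ else 0)).comp
    (AlgEquiv.ofBijective _ A.free).symm.toAlgHom

theorem projection_elem (A : OPG 𝒜 a) (B : OPG ℬ b) (n : ℕ+) (i : Fin (a n)) :
    projection A B (A.elem n i) = if h : (i : ℕ) < b n then B.elem n ⟨i, h⟩ else 0 := by
  have h1 : (AlgEquiv.ofBijective _ A.free).symm (A.elem n i) =
      FreeAlgebra.ι ℂ (⟨n, i⟩ : Σ n : ℕ+, Fin (a n)) := by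
    rw [AlgEquiv.symm_apply_eq]
    simp
  simp [projection, h1]

end Maps

end FGCCHA

end

/-!
Call an element of degree `n` decomposable if it is a sum of products of homogeneous elements of
positive degrees, and let `Q_n` be the quotient of the degree `n` component by its decomposable
elements. Free homogeneous generators of degree `n` form a basis of `Q_n`
(`exists_basis_indecomposables`), so `dim Q_n` is the number of generators, and a surjective
homomorphism of graded algebras induces surjections on the spaces `Q_n`. Conversely, by a graded
Nakayama argument and a dimension count, a family of homogeneous elements with the right number of
members in each degree generates freely as soon as it spans every `Q_n` (`free_of_graded_le`).

Cocommutativity enters through `exists_primitive_sub_mem_decomposables`: every homogeneous element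
of positive degree is congruent to a primitive element modulo decomposables. The primitive element
is its image under the convolution logarithm of the identity. Hence primitive generating sets can be
chosen by linear algebra in the spaces `Q_n`.

Given a surjective homomorphism `f : H → K`, choose primitive elements of `H` spanning each `Q_n(H)`
such that the images under `f` of the first `b n` of them span `Q_n(K)`. These images form an
ordered primitive generating set of `K`, and lifting them back defines a Hopf algebra section `s` of
`f`. Replacing each remaining primitive element `p` by `p - s (f p)` keeps it primitive, does not
change the span, and puts it in the kernel of `f`; so `f` is a coordinate projection
(`exists_eq_projection`). Doubling all generators on both sides gives the same projection, so the
pair of generating sets is not unique when `a ≠ 0`.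
-/

noncomputable section

namespace FGCCHA

/-! ### Graded algebras generated in positive degrees -/

section Graded

variable {A : Type*} [Ring A] [Algebra ℂ A]

/-- The decomposable elements of degree `n`: sums of products of two homogeneous elements of
positive degrees adding up to `n`. -/
def decomposables (𝒜 : ℕ → Submodule ℂ A) (n : ℕ) : Submodule ℂ A :=
  ⨆ p ∈ {p ∈ Finset.HasAntidiagonal.antidiagonal n | p.1 ≠ 0 ∧ p.2 ≠ 0}, 𝒜 p.1 * 𝒜 p.2

theorem decomposables_le_iff {𝒜 : ℕ → Submodule ℂ A} {n : ℕ} {M : Submodule ℂ A} :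
    decomposables 𝒜 n ≤ M ↔
      ∀ i j, i + j = n → i ≠ 0 → j ≠ 0 → ∀ x ∈ 𝒜 i, ∀ y ∈ 𝒜 j, x * y ∈ M := by
  simp [decomposables, Submodule.mul_le, iSup_le_iff]

theorem mul_mem_decomposables {𝒜 : ℕ → Submodule ℂ A} {i j n : ℕ} (h : i + j = n) (hi : i ≠ 0)
    (hj : j ≠ 0) {x y : A} (hx : x ∈ 𝒜 i) (hy : y ∈ 𝒜 j) : x * y ∈ decomposables 𝒜 n :=
  decomposables_le_iff.1 le_rfl i j h hi hj x hx y hy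

theorem decomposables_le (𝒜 : ℕ → Submodule ℂ A) [GradedAlgebra 𝒜] (n : ℕ) :
    decomposables 𝒜 n ≤ 𝒜 n :=
  decomposables_le_iff.2 fun _ _ h _ _ _ hx _ hy => h ▸ SetLike.mul_mem_graded hx hy

theorem map_mem_decomposables {B : Type*} [Ring B] [Algebra ℂ B] {𝒜 : ℕ → Submodule ℂ A}
    {ℬ : ℕ → Submodule ℂ B} (φ : A →ₐ[ℂ] B) (hφ : ∀ n, ∀ x ∈ 𝒜 n, φ x ∈ ℬ n) {n : ℕ} {x : A}
    (hx : x ∈ decomposables 𝒜 n) : φ x ∈ decomposables ℬ n := by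
  have : decomposables 𝒜 n ≤ (decomposables ℬ n).comap φ.toLinearMap :=
    decomposables_le_iff.2 fun i j h hi hj x hx y hy => by
      simpa using mul_mem_decomposables h hi hj (hφ i x hx) (hφ j y hy)
  exact this hx

variable {𝒜 : ℕ → Submodule ℂ A} {κ : ℕ+ → Type*} {x : ∀ n, κ n → A}

/-- An algebra homomorphism is homogeneous as soon as it is so on homogeneous generators of
positive degree. -/
theorem map_mem_of_generators {B : Type*} [Ring B] [Algebra ℂ B] {ℬ : ℕ → Submodule ℂ B}
    [GradedAlgebra ℬ] (h0 : 𝒜 0 ≤ 1)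
    (h : ∀ n : ℕ+, 𝒜 n ≤ Submodule.span ℂ (Set.range (x n)) ⊔ decomposables 𝒜 n)
    (φ : A →ₐ[ℂ] B) (hφ : ∀ (n : ℕ+) i, φ (x n i) ∈ ℬ n) (n : ℕ) : ∀ y ∈ 𝒜 n, φ y ∈ ℬ n := by
  suffices 𝒜 n ≤ (ℬ n).comap φ.toLinearMap from this
  induction n using Nat.strong_induction_on with
  | _ n ih =>
    rcases Nat.eq_zero_or_pos n with rfl | hn
    · refine h0.trans (Submodule.one_le.2 ?_)
      simpa using SetLike.one_mem_graded ℬ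
    · refine (h ⟨n, hn⟩).trans (sup_le (Submodule.span_le.2 ?_)
        (decomposables_le_iff.2 fun i j hij hi hj u hu v hv => ?_))
      · rintro _ ⟨i, rfl⟩
        exact hφ ⟨n, hn⟩ i
      · have hij' : i + j = n := hij
        have := SetLike.mul_mem_graded (A := ℬ) (ih i (by omega) hu) (ih j (by omega) hv)
        rw [hij'] at this
        simpa using this

theorem fg_of_graded_le [hκ : ∀ n, Finite (κ n)] (h0 : 𝒜 0 ≤ 1)
    (h : ∀ n : ℕ+, 𝒜 n ≤ Submodule.span ℂ (Set.range (x n)) ⊔ decomposables 𝒜 n) (n : ℕ) :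
    (𝒜 n).FG := by
  induction n using Nat.strong_induction_on with
  | _ n ih =>
    rcases Nat.eq_zero_or_pos n with rfl | hn
    · refine Submodule.FG.of_le ?_ h0
      rw [Submodule.one_eq_span]
      exact Submodule.fg_span_singleton 1
    · have := hκ ⟨n, hn⟩
      have hspan := Submodule.fg_span (R := ℂ) (Set.finite_range (x ⟨n, hn⟩))
      refine Submodule.FG.of_le (hspan.sup ?_) (h ⟨n, hn⟩)
      refine Submodule.fg_biSup _ _ fun p hp => ?_
      simp only [Finset.mem_filter, Finset.HasAntidiagonal.mem_antidiagonal, PNat.mk_coe] at hp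
      exact (ih p.1 (by omega)).mul (ih p.2 (by omega))

variable [GradedAlgebra 𝒜]

/-- An algebra generated by homogeneous elements of positive degree is spanned in degree `n` by the
generators of degree `n` and the decomposables, and in degree `0` by `1`. The two cases are
combined in the family of submodules on the right-hand side. -/
theorem graded_le_of_surjective (hx : ∀ (n : ℕ+) i, x n i ∈ 𝒜 n)
    (hs : Function.Surjective (FreeAlgebra.lift ℂ fun p : Σ n, κ n => x p.1 p.2)) (n : ℕ) :
    𝒜 n ≤ if h : 0 < n then Submodule.span ℂ (Set.range (x ⟨n, h⟩)) ⊔ decomposables 𝒜 n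
      else 1 := by
  set S : ℕ → Submodule ℂ A := fun n => if h : 0 < n then
    Submodule.span ℂ (Set.range (x ⟨n, h⟩)) ⊔ decomposables 𝒜 n else 1 with hS
  have S0 : S 0 = 1 := by simp [hS]
  have Sle : ∀ n, S n ≤ 𝒜 n := by
    intro n
    by_cases h : 0 < n
    · simp only [hS, h, dif_pos]
      refine sup_le (Submodule.span_le.2 ?_) (decomposables_le 𝒜 n)
      rintro _ ⟨i, rfl⟩
      exact hx ⟨n, h⟩ i
    · obtain rfl : n = 0 := by omega
      rw [S0, Submodule.one_le]
      exact SetLike.one_mem_graded 𝒜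
  have Smul : ∀ i j, S i * S j ≤ S (i + j) := by
    intro i j
    rcases Nat.eq_zero_or_pos i with rfl | hi
    · simp [S0]
    rcases Nat.eq_zero_or_pos j with rfl | hj
    · simp [S0]
    have : decomposables 𝒜 (i + j) ≤ S (i + j) := by
      simp only [hS, show 0 < i + j by omega, dif_pos]
      exact le_sup_right
    refine le_trans (Submodule.mul_le.2 fun u hu v hv => ?_) this
    exact mul_mem_decomposables rfl hi.ne' hj.ne' (Sle i hu) (Sle j hv)
  have Stop : ∀ y : A, y ∈ ⨆ n, S n := by
    intro y
    obtain ⟨w, rfl⟩ := hs y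
    induction w using FreeAlgebra.induction with
    | grade0 r =>
      rw [AlgHom.commutes]
      exact Submodule.mem_iSup_of_mem 0 (S0 ▸ Submodule.algebraMap_mem r)
    | grade1 p =>
      refine Submodule.mem_iSup_of_mem (p.1 : ℕ) ?_
      simp only [hS, p.1.pos, dif_pos, FreeAlgebra.lift_ι_apply]
      exact Submodule.mem_sup_left (Submodule.subset_span ⟨p.2, rfl⟩)
    | mul u v hu hv =>
      rw [map_mul]
      have := Submodule.mul_mem_mul hu hv
      rw [Submodule.iSup_mul] at this
      refine (iSup_le fun i => ?_ : _ ≤ ⨆ n, S n) this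
      rw [Submodule.mul_iSup]
      exact iSup_le fun j => (Smul i j).trans (le_iSup S _)
    | add u v hu hv =>
      rw [map_add]
      exact add_mem hu hv
  -- the degree `n` component of an element of `⨆ m, S m` lies in `S n`
  intro y hy
  have key : ∀ z ∈ ⨆ n, S n, ((DirectSum.decompose 𝒜 z n : 𝒜 n) : A) ∈ S n := by
    intro z hz
    induction hz using Submodule.iSup_induction' with
    | mem m z hz =>
      by_cases hmn : m = n
      · subst hmn
        rwa [DirectSum.decompose_of_mem_same 𝒜 (Sle m hz)]
      · rw [DirectSum.decompose_of_mem_ne 𝒜 (Sle m hz) hmn]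
        exact zero_mem _
    | zero => simp
    | add u v _ _ hu hv =>
      rw [DirectSum.decompose_add]
      exact add_mem hu hv
  have := key y (Stop y)
  rwa [DirectSum.decompose_of_mem_same 𝒜 hy] at this

theorem graded_zero_le_one (hx : ∀ (n : ℕ+) i, x n i ∈ 𝒜 n)
    (hs : Function.Surjective (FreeAlgebra.lift ℂ fun p : Σ n, κ n => x p.1 p.2)) : 𝒜 0 ≤ 1 := by
  simpa using graded_le_of_surjective hx hs 0

theorem graded_le_span_sup (hx : ∀ (n : ℕ+) i, x n i ∈ 𝒜 n)
    (hs : Function.Surjective (FreeAlgebra.lift ℂ fun p : Σ n, κ n => x p.1 p.2)) (n : ℕ+) :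
    𝒜 n ≤ Submodule.span ℂ (Set.range (x n)) ⊔ decomposables 𝒜 n := by
  have := graded_le_of_surjective hx hs n
  rwa [dif_pos n.pos] at this

/-- Graded Nakayama lemma: homogeneous elements which span modulo decomposables generate. -/
theorem surjective_of_graded_le (h0 : 𝒜 0 ≤ 1)
    (h : ∀ n : ℕ+, 𝒜 n ≤ Submodule.span ℂ (Set.range (x n)) ⊔ decomposables 𝒜 n) :
    Function.Surjective (FreeAlgebra.lift ℂ fun p : Σ n, κ n => x p.1 p.2) := by
  set R := (FreeAlgebra.lift ℂ fun p : Σ n, κ n => x p.1 p.2).range with hR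
  have hle : ∀ n, 𝒜 n ≤ Subalgebra.toSubmodule R := by
    intro n
    induction n using Nat.strong_induction_on with
    | _ n ih =>
      rcases Nat.eq_zero_or_pos n with rfl | hn
      · exact h0.trans (Submodule.one_le.2 (one_mem R))
      · refine (h ⟨n, hn⟩).trans (sup_le (Submodule.span_le.2 ?_)
          (decomposables_le_iff.2 fun i j hij hi hj u hu v hv => ?_))
        · rintro _ ⟨i, rfl⟩
          exact ⟨FreeAlgebra.ι ℂ ⟨⟨n, hn⟩, i⟩, by simp⟩
        · have hij' : i + j = n := hij
          exact R.mul_mem (ih i (by omega) hu) (ih j (by omega) hv)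
  classical
  intro y
  change y ∈ R
  rw [← DirectSum.sum_support_decompose 𝒜 y]
  exact sum_mem fun i _ => hle i (SetLike.coe_mem _)

theorem decompose_map {B : Type*} [Ring B] [Algebra ℂ B] {ℬ : ℕ → Submodule ℂ B}
    [GradedAlgebra ℬ] (φ : A →ₐ[ℂ] B) (hφ : ∀ n, ∀ x ∈ 𝒜 n, φ x ∈ ℬ n) (y : A) (n : ℕ) :
    (DirectSum.decompose ℬ (φ y) n : B) = φ (DirectSum.decompose 𝒜 y n) := by
  induction y using DirectSum.Decomposition.inductionOn 𝒜 with
  | zero => simp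
  | @homogeneous i m =>
    by_cases hi : i = n
    · subst hi
      rw [DirectSum.decompose_of_mem_same ℬ (hφ _ _ m.2),
        DirectSum.decompose_of_mem_same 𝒜 m.2]
    · rw [DirectSum.decompose_of_mem_ne ℬ (hφ _ _ m.2) hi,
        DirectSum.decompose_of_mem_ne 𝒜 m.2 hi, map_zero]
  | add u v hu hv => simp [DirectSum.decompose_add, hu, hv]

/-- In an algebra freely generated by finitely many homogeneous elements in each positive degree,
the same number of homogeneous elements in each degree generates freely as soon as it spans modulo
decomposables: the endomorphism taking one family to the other is onto, and it restricts to the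
finite-dimensional homogeneous components, so it is injective. -/
theorem free_of_graded_le [∀ n, Finite (κ n)] (hx : ∀ (n : ℕ+) i, x n i ∈ 𝒜 n)
    (hfree : Function.Bijective (FreeAlgebra.lift ℂ fun p : Σ n, κ n => x p.1 p.2)) {y : ∀ n, κ n → A}
    (hy : ∀ (n : ℕ+) i, y n i ∈ 𝒜 n)
    (h : ∀ n : ℕ+, 𝒜 n ≤ Submodule.span ℂ (Set.range (y n)) ⊔ decomposables 𝒜 n) :
    Function.Bijective (FreeAlgebra.lift ℂ fun p : Σ n, κ n => y p.1 p.2) := by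
  have h0 := graded_zero_le_one hx hfree.2
  have hxs := graded_le_span_sup hx hfree.2
  have hsurj := surjective_of_graded_le h0 h
  let e := AlgEquiv.ofBijective _ hfree
  let ψ : A →ₐ[ℂ] A := (FreeAlgebra.lift ℂ fun p : Σ n, κ n => y p.1 p.2).comp e.symm.toAlgHom
  have he : ∀ n i, e.symm (x n i) = FreeAlgebra.ι ℂ (⟨n, i⟩ : Σ n, κ n) := by
    intro n i
    rw [AlgEquiv.symm_apply_eq]
    simp [e]
  have hψx : ∀ n i, ψ (x n i) = y n i := by
    intro n i
    simp [ψ, he]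
  have hψ := map_mem_of_generators (ℬ := 𝒜) h0 hxs ψ (fun n i => (hψx n i).symm ▸ hy n i)
  have hψs : Function.Surjective ψ := by
    intro z
    obtain ⟨w, hw⟩ := hsurj z
    exact ⟨e w, by simpa [ψ] using hw⟩
  have hψi : Function.Injective ψ := by
    rw [injective_iff_map_eq_zero]
    intro z hz
    have hcomp : ∀ n, (DirectSum.decompose 𝒜 z n : A) = 0 := by
      intro n
      have : Module.Finite ℂ (𝒜 n) := Module.Finite.iff_fg.2 (fg_of_graded_le h0 hxs n)
      let r : 𝒜 n →ₗ[ℂ] 𝒜 n := ψ.toLinearMap.restrict (hψ n)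
      have hr : Function.Surjective r := by
        intro v
        obtain ⟨w, hw⟩ := hψs v
        refine ⟨DirectSum.decompose 𝒜 w n, Subtype.ext ?_⟩
        change ψ (DirectSum.decompose 𝒜 w n : A) = _
        rw [← decompose_map ψ hψ, hw, DirectSum.decompose_of_mem_same 𝒜 v.2]
      have hri : Function.Injective r := LinearMap.injective_iff_surjective.2 hr
      have : DirectSum.decompose 𝒜 z n = 0 := by
        apply hri
        rw [map_zero]
        refine Subtype.ext ?_
        change ψ (DirectSum.decompose 𝒜 z n : A) = _
        rw [← decompose_map ψ hψ, hz]
        simp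
      simp [this]
    classical
    rw [← DirectSum.sum_support_decompose 𝒜 z]
    exact Finset.sum_eq_zero fun n _ => hcomp n
  refine ⟨?_, hsurj⟩
  have : ⇑(FreeAlgebra.lift ℂ fun p : Σ n, κ n => y p.1 p.2) = ψ ∘ e := by
    ext w
    simp [ψ]
  rw [this]
  exact hψi.comp e.injective

end Graded

/-! ### Binomial coefficients as polynomials -/

section Binomial

open Polynomial

/-- The binomial coefficient `t ↦ t choose k` as a polynomial. -/
def binomialPoly (k : ℕ) : ℂ[X] := C ((k.factorial : ℂ)⁻¹) * descPochhammer ℂ k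

theorem eval_binomialPoly (k m : ℕ) : (binomialPoly k).eval (m : ℂ) = m.choose k := by
  have hk : (k.factorial : ℂ) ≠ 0 := Nat.cast_ne_zero.2 k.factorial_ne_zero
  rw [binomialPoly, eval_mul, eval_C, descPochhammer_eval_eq_descFactorial,
    Nat.descFactorial_eq_factorial_mul_choose]
  push_cast
  field_simp

theorem coeff_zero_binomialPoly (k : ℕ) : (binomialPoly k).coeff 0 = if k = 0 then 1 else 0 := by
  rw [coeff_zero_eq_eval_zero, ← Nat.cast_zero (R := ℂ), eval_binomialPoly]
  cases k <;> simp

theorem binomialPoly_zero : binomialPoly 0 = 1 := by simp [binomialPoly]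

theorem binomialPoly_one : binomialPoly 1 = X := by simp [binomialPoly]

/-- A polynomial identity with vector coefficients which holds at all natural numbers holds
coefficientwise. -/
theorem sum_coeff_smul_eq {V : Type*} [AddCommGroup V] [Module ℂ V] {σ τ : Type*} {s : Finset σ}
    {t : Finset τ} {p : σ → ℂ[X]} {q : τ → ℂ[X]} {v : σ → V} {w : τ → V}
    (h : ∀ m : ℕ, ∑ i ∈ s, (p i).eval (m : ℂ) • v i = ∑ j ∈ t, (q j).eval (m : ℂ) • w j) (r : ℕ) :
    ∑ i ∈ s, (p i).coeff r • v i = ∑ j ∈ t, (q j).coeff r • w j := by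
  rw [← sub_eq_zero, ← Module.forall_dual_apply_eq_zero_iff ℂ]
  intro φ
  have hpq : ∑ i ∈ s, C (φ (v i)) * p i = ∑ j ∈ t, C (φ (w j)) * q j := by
    refine eq_of_infinite_eval_eq _ _ ((Set.infinite_range_of_injective
      (Nat.cast_injective (R := ℂ))).mono ?_)
    rintro _ ⟨m, rfl⟩
    simpa [eval_finsetSum, mul_comm] using congrArg φ (h m)
  simpa [mul_comm, sub_eq_zero] using congrArg (fun f => f.coeff r) hpq

variable {R V : Type*} [Ring R] [Algebra ℂ R] [AddCommGroup V] [Module ℂ V]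

theorem add_one_pow_eq_sum_binomialPoly (u : R) {m N : ℕ} (h : m ≤ N) :
    (u + 1) ^ m = ∑ k ∈ Finset.range (N + 1), (binomialPoly k).eval (m : ℂ) • u ^ k := by
  rw [(Commute.one_right u).add_pow]
  refine (Finset.sum_congr rfl fun k _ => ?_).trans
    (Finset.sum_subset (Finset.range_mono (by omega)) fun k _ hk => ?_)
  · rw [eval_binomialPoly, one_pow, mul_one, Nat.cast_smul_eq_nsmul, nsmul_eq_mul]
    exact (Nat.cast_commute _ _).symm
  · rw [eval_binomialPoly, Nat.choose_eq_zero_of_lt (by simpa using hk)]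
    simp

/-- Binomial expansion of `(1 + u) ^ m` after applying a linear map killing the high powers of `u`:
a polynomial in `m`. -/
theorem apply_add_one_pow (L : R →ₗ[ℂ] V) {u : R} {n : ℕ} (hu : ∀ k, n < k → L (u ^ k) = 0)
    (m : ℕ) : L ((u + 1) ^ m) =
      ∑ k ∈ Finset.range (n + 1), (binomialPoly k).eval (m : ℂ) • L (u ^ k) := by
  rw [add_one_pow_eq_sum_binomialPoly u (le_max_left m n), map_sum]
  simp only [map_smul]
  refine (Finset.sum_subset (Finset.range_mono (by simp)) fun k _ hk => ?_).symm
  rw [hu k (by simpa using hk), smul_zero]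

theorem apply_add_one_pow_mul (L : R →ₗ[ℂ] V) {u v : R} {n : ℕ}
    (huv : ∀ i j, n < i + j → L (u ^ i * v ^ j) = 0) (m : ℕ) :
    L ((u + 1) ^ m * (v + 1) ^ m) =
      ∑ p ∈ Finset.range (n + 1) ×ˢ Finset.range (n + 1),
        (binomialPoly p.1 * binomialPoly p.2).eval (m : ℂ) • L (u ^ p.1 * v ^ p.2) := by
  rw [add_one_pow_eq_sum_binomialPoly u (le_max_left m n),
    add_one_pow_eq_sum_binomialPoly v (le_max_left m n), Finset.sum_mul_sum,
    ← Finset.sum_product', map_sum]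
  have hmono : Finset.range (n + 1) ⊆ Finset.range (max m n + 1) := Finset.range_mono (by simp)
  refine Eq.symm ((Finset.sum_subset (Finset.product_subset_product hmono hmono)
    fun p _ hp => ?_).trans (Finset.sum_congr rfl fun p _ => ?_))
  · simp only [Finset.mem_product, Finset.mem_range, not_and_or] at hp
    rw [huv p.1 p.2 (by omega), smul_zero]
  · rw [eval_mul, smul_mul_smul_comm, map_smul]

end Binomial

/-! ### The first Eulerian idempotent -/

section Eulerian

open WithConv

variable {H : Type*} [Ring H] [HopfAlgebra ℂ H]

/-- Composition with an algebra homomorphism, as a ring homomorphism of convolution algebras. -/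
def convPostcomp {A B : Type*} [Ring A] [Algebra ℂ A] [Ring B] [Algebra ℂ B] (j : A →ₐ[ℂ] B) :
    WithConv (H →ₗ[ℂ] A) →+* WithConv (H →ₗ[ℂ] B) where
  toFun F := toConv (j.toLinearMap ∘ₗ F.ofConv)
  map_one' := by ext x; simp [LinearMap.convOne_def]
  map_mul' F G := congrArg toConv (LinearMap.algHom_comp_convMul_distrib j F G)
  map_zero' := by ext x; simp
  map_add' F G := by ext x; simp

/-- Evaluation at `x`, as a linear map on the convolution algebra. -/
def convEval (A : Type*) [Ring A] [Algebra ℂ A] (x : H) : WithConv (H →ₗ[ℂ] A) →ₗ[ℂ] A where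
  toFun F := F x
  map_add' _ _ := rfl
  map_smul' _ _ := rfl

/-- The convolution-algebra element `id - η ∘ ε`. -/
def idSubUnit (H : Type*) [Ring H] [HopfAlgebra ℂ H] : WithConv (H →ₗ[ℂ] H) :=
  toConv LinearMap.id - 1

theorem idSubUnit_apply (x : H) :
    idSubUnit H x = x - algebraMap ℂ H (Coalgebra.counit (R := ℂ) x) := rfl

variable {𝒜 : ℕ → Submodule ℂ H}

theorem map_mem_of_mem_tensorDegree {M : Type*} [AddCommGroup M] [Module ℂ M]
    (L : H ⊗[ℂ] H →ₗ[ℂ] M) {S : Submodule ℂ M} {n : ℕ}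
    (h : ∀ i j, i + j = n → ∀ u ∈ 𝒜 i, ∀ v ∈ 𝒜 j, L (u ⊗ₜ v) ∈ S) {t : H ⊗[ℂ] H}
    (ht : t ∈ tensorDegree 𝒜 n) : L t ∈ S := by
  suffices tensorDegree 𝒜 n ≤ S.comap L from this ht
  refine iSup₂_le fun p hp => ?_
  rw [Finset.HasAntidiagonal.mem_antidiagonal] at hp
  rintro _ ⟨w, rfl⟩
  induction w using TensorProduct.induction_on with
  | zero => simp
  | tmul u v => exact h _ _ hp _ u.2 _ v.2
  | add w w' hw hw' =>
    rw [map_add]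
    exact add_mem hw hw'

theorem convMul_mem (hg : ∀ n, ∀ x ∈ 𝒜 n, Coalgebra.comul (R := ℂ) x ∈ tensorDegree 𝒜 n)
    {B : Type*} [Ring B] [Algebra ℂ B]
    {F G : WithConv (H →ₗ[ℂ] B)} {S : Submodule ℂ B} {n : ℕ}
    (h : ∀ i j, i + j = n → ∀ u ∈ 𝒜 i, ∀ v ∈ 𝒜 j, F u * G v ∈ S) {x : H} (hx : x ∈ 𝒜 n) :
    (F * G) x ∈ S :=
  map_mem_of_mem_tensorDegree (LinearMap.mul' ℂ B ∘ₗ TensorProduct.map F.ofConv G.ofConv)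
    (fun i j hij u hu v hv => by simpa using h i j hij u hu v hv) (hg n x hx)

theorem convMul_apply_eq_zero
    (hg : ∀ n, ∀ x ∈ 𝒜 n, Coalgebra.comul (R := ℂ) x ∈ tensorDegree 𝒜 n)
    {B : Type*} [Ring B] [Algebra ℂ B] {F G : WithConv (H →ₗ[ℂ] B)} {p q n : ℕ}
    (hF : ∀ i < p, ∀ u ∈ 𝒜 i, F u = 0) (hG : ∀ j < q, ∀ v ∈ 𝒜 j, G v = 0) (hn : n < p + q)
    {x : H} (hx : x ∈ 𝒜 n) : (F * G) x = 0 := by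
  rw [← Submodule.mem_bot ℂ]
  refine convMul_mem hg (fun i j hij u hu v hv => ?_) hx
  rw [Submodule.mem_bot]
  rcases lt_or_ge i p with hi | hi
  · rw [hF i hi u hu, zero_mul]
  · rw [hG j (by omega) v hv, mul_zero]

theorem idSubUnit_apply_eq_zero (h0 : 𝒜 0 ≤ 1) {x : H} (hx : x ∈ 𝒜 0) : idSubUnit H x = 0 := by
  obtain ⟨r, rfl⟩ := Submodule.mem_one.1 (h0 hx)
  simp [idSubUnit_apply]

/-- In a connected graded Hopf algebra, the `k`-th convolution power of `id - η ∘ ε` vanishes in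
degrees below `k`. -/
theorem idSubUnit_pow_apply_eq_zero
    (hg : ∀ n, ∀ x ∈ 𝒜 n, Coalgebra.comul (R := ℂ) x ∈ tensorDegree 𝒜 n) (h0 : 𝒜 0 ≤ 1)
    (k : ℕ) : ∀ n < k, ∀ x ∈ 𝒜 n, (idSubUnit H ^ k) x = 0 := by
  induction k with
  | zero => simp
  | succ k ih =>
    intro n hn x hx
    rw [pow_succ]
    refine convMul_apply_eq_zero hg (q := 1) ih (fun j hj v hv => ?_) hn hx
    obtain rfl : j = 0 := by omega
    exact idSubUnit_apply_eq_zero h0 hv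

theorem idSubUnit_apply_eq_self (hG : ∀ n, n ≠ 0 → ∀ x ∈ 𝒜 n, Coalgebra.counit (R := ℂ) x = 0)
    {n : ℕ} (hn : n ≠ 0) {x : H} (hx : x ∈ 𝒜 n) : idSubUnit H x = x := by
  rw [idSubUnit_apply, hG n hn x hx, map_zero, sub_zero]

theorem idSubUnit_pow_mem_decomposables [GradedAlgebra 𝒜] (hG : IsGradedHopf 𝒜) (h0 : 𝒜 0 ≤ 1)
    (k : ℕ) : ∀ n, ∀ x ∈ 𝒜 n, (idSubUnit H ^ (k + 2)) x ∈ decomposables 𝒜 n := by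
  have h1 : ∀ n, ∀ x ∈ 𝒜 n, (idSubUnit H) x ∈ 𝒜 n := by
    intro n x hx
    rcases eq_or_ne n 0 with rfl | hn
    · rw [idSubUnit_apply_eq_zero h0 hx]
      exact zero_mem _
    · rwa [idSubUnit_apply_eq_self hG.counit_eq_zero hn hx]
  have step : ∀ k, (∀ n, ∀ x ∈ 𝒜 n, (idSubUnit H ^ (k + 1)) x ∈ 𝒜 n) →
      ∀ n, ∀ x ∈ 𝒜 n, (idSubUnit H ^ (k + 2)) x ∈ decomposables 𝒜 n := by
    intro k hk n x hx
    rw [pow_succ]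
    refine convMul_mem hG.comul_mem (fun i j hij u hu v hv => ?_) hx
    rcases eq_or_ne i 0 with rfl | hi
    · rw [idSubUnit_pow_apply_eq_zero hG.comul_mem h0 (k + 1) 0 (by omega) u hu, zero_mul]
      exact zero_mem _
    rcases eq_or_ne j 0 with rfl | hj
    · rw [idSubUnit_apply_eq_zero h0 hv, mul_zero]
      exact zero_mem _
    exact mul_mem_decomposables hij hi hj (hk i u hu) (h1 j v hv)
  refine step k ?_
  induction k with
  | zero => simpa using h1
  | succ k ih => exact fun n x hx => decomposables_le 𝒜 n (step k ih n x hx)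

theorem comul_comp_conv_pow [Coalgebra.IsCocomm ℂ H] (m : ℕ) :
    convPostcomp (Bialgebra.comulAlgHom ℂ H) (toConv (LinearMap.id : H →ₗ[ℂ] H) ^ m) =
      convPostcomp Algebra.TensorProduct.includeLeft (toConv (LinearMap.id : H →ₗ[ℂ] H)) ^ m *
      convPostcomp Algebra.TensorProduct.includeRight (toConv (LinearMap.id : H →ₗ[ℂ] H)) ^ m := by
  set I := toConv (LinearMap.id : H →ₗ[ℂ] H)
  set I₁ : WithConv (H →ₗ[ℂ] H ⊗[ℂ] H) := convPostcomp Algebra.TensorProduct.includeLeft I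
  set I₂ : WithConv (H →ₗ[ℂ] H ⊗[ℂ] H) := convPostcomp Algebra.TensorProduct.includeRight I
  have h12 : I₁ * I₂ = convPostcomp (Bialgebra.comulAlgHom ℂ H) I := by
    have : LinearMap.mul' ℂ (H ⊗[ℂ] H) ∘ₗ TensorProduct.map I₁.ofConv I₂.ofConv =
        LinearMap.id := by
      ext u v
      change (u ⊗ₜ[ℂ] (1 : H)) * ((1 : H) ⊗ₜ[ℂ] v) = u ⊗ₜ v
      simp
    ext x
    exact LinearMap.congr_fun this (Coalgebra.comul (R := ℂ) x)
  have h21 : I₂ * I₁ = convPostcomp (Bialgebra.comulAlgHom ℂ H) I := by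
    have : LinearMap.mul' ℂ (H ⊗[ℂ] H) ∘ₗ TensorProduct.map I₂.ofConv I₁.ofConv =
        (TensorProduct.comm ℂ H H).toLinearMap := by
      ext u v
      change ((1 : H) ⊗ₜ[ℂ] u) * (v ⊗ₜ[ℂ] (1 : H)) = v ⊗ₜ u
      simp
    ext x
    exact (LinearMap.congr_fun this (Coalgebra.comul (R := ℂ) x)).trans
      (Coalgebra.comm_comul ℂ x)
  have hc : Commute I₁ I₂ := h12.trans h21.symm
  rw [map_pow, ← h12, hc.mul_pow]

/-- In a connected graded cocommutative Hopf algebra over `ℂ`, every homogeneous element of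
positive degree is primitive modulo decomposables. The primitive element is the image of `x` under
the first Eulerian idempotent, the convolution logarithm of the identity: the coefficient of `t` in
the polynomial `t ↦ id ^ t`, where `id ^ t = ∑ k, (t choose k) (id - η ∘ ε) ^ k`. By
cocommutativity `Δ ∘ id ^ t = (id ^ t ⊗ id ^ t) ∘ Δ`, and the coefficient of `t` in this identity
says that the image is primitive. -/
theorem exists_primitive_sub_mem_decomposables [GradedAlgebra 𝒜] (hG : IsGradedHopf 𝒜)
    (hC : Coalgebra.IsCocomm ℂ H) (h0 : 𝒜 0 ≤ 1) {n : ℕ} (hn : n ≠ 0) {x : H} (hx : x ∈ 𝒜 n) :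
    ∃ p ∈ 𝒜 n, IsPrimitiveElement p ∧ x - p ∈ decomposables 𝒜 n := by
  set J := idSubUnit H with hJ
  have hI : toConv (LinearMap.id : H →ₗ[ℂ] H) = J + 1 := (sub_add_cancel _ _).symm
  set J₁ : WithConv (H →ₗ[ℂ] H ⊗[ℂ] H) := convPostcomp Algebra.TensorProduct.includeLeft J with hJ₁
  set J₂ : WithConv (H →ₗ[ℂ] H ⊗[ℂ] H) := convPostcomp Algebra.TensorProduct.includeRight J with hJ₂
  have hJ0 := idSubUnit_pow_apply_eq_zero hG.comul_mem h0
  have h1 : ∀ k y, (J₁ ^ k) y = (J ^ k) y ⊗ₜ[ℂ] (1 : H) := by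
    intro k y
    rw [hJ₁, ← map_pow]
    rfl
  have h2 : ∀ k y, (J₂ ^ k) y = (1 : H) ⊗ₜ[ℂ] (J ^ k) y := by
    intro k y
    rw [hJ₂, ← map_pow]
    rfl
  have h12 : ∀ i j, n < i + j → (J₁ ^ i * J₂ ^ j) x = 0 := by
    intro i j hij
    refine convMul_apply_eq_zero hG.comul_mem (p := i) (q := j) (fun k hk u hu => ?_)
      (fun k hk u hu => ?_) hij hx
    · rw [h1, hJ0 i k hk u hu, TensorProduct.zero_tmul]
    · rw [h2, hJ0 j k hk u hu, TensorProduct.tmul_zero]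
  set c : ℕ → ℂ := fun k => (binomialPoly k).coeff 1 with hc
  set p : H := ∑ k ∈ Finset.range (n + 1), c k • (J ^ k) x with hp
  have key : ∑ k ∈ Finset.range (n + 1), c k • Coalgebra.comul (R := ℂ) ((J ^ k) x) =
      ∑ q ∈ Finset.range (n + 1) ×ˢ Finset.range (n + 1),
        (binomialPoly q.1 * binomialPoly q.2).coeff 1 • (J₁ ^ q.1 * J₂ ^ q.2) x := by
    refine sum_coeff_smul_eq (fun m => ?_) 1
    have hL := apply_add_one_pow (convEval H x) (u := J) (n := n)
      (fun k hk => hJ0 k n hk x hx) m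
    have hR := apply_add_one_pow_mul (convEval (H ⊗[ℂ] H) x) h12 m
    have hΔ := congrArg (convEval (H ⊗[ℂ] H) x) (comul_comp_conv_pow (H := H) m)
    rw [hI, map_add, map_add, map_one, map_one] at hΔ
    refine Eq.trans ?_ (hΔ.trans hR)
    change _ = Coalgebra.comul (R := ℂ) (convEval H x ((J + 1) ^ m))
    rw [hL, map_sum]
    simp only [map_smul]
    rfl
  have hc01 : ∀ i j, (binomialPoly i * binomialPoly j).coeff 1 =
      (if i = 0 then c j else 0) + (if j = 0 then c i else 0) := by
    intro i j
    rw [Polynomial.mul_coeff_one, coeff_zero_binomialPoly, coeff_zero_binomialPoly]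
    simp [hc]
  have hc0 : c 0 = 0 := by simp [hc, binomialPoly_zero, Polynomial.coeff_one]
  have hc1 : c 1 = 1 := by simp [hc, binomialPoly_one]
  have hxp : p - x ∈ decomposables 𝒜 n := by
    obtain ⟨n', rfl⟩ := Nat.exists_eq_succ_of_ne_zero hn
    rw [hp, Finset.sum_range_succ', Finset.sum_range_succ', hc0, hc1, zero_smul, add_zero,
      one_smul, zero_add, pow_one, hJ, idSubUnit_apply_eq_self hG.counit_eq_zero hn hx,
      add_sub_cancel_right]
    exact sum_mem fun k _ => Submodule.smul_mem _ _
      (idSubUnit_pow_mem_decomposables hG h0 k _ x hx)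
  refine ⟨p, ?_, ?_, by simpa using neg_mem hxp⟩
  · simpa using add_mem (decomposables_le 𝒜 n hxp) hx
  · have hn1 : 0 ∈ Finset.range (n + 1) := by simp
    rw [IsPrimitiveElement, hp, map_sum]
    simp only [map_smul]
    rw [key, Finset.sum_product]
    simp only [hc01, add_smul, Finset.sum_add_distrib, ite_smul, zero_smul]
    rw [Finset.sum_comm]
    simp only [Finset.sum_ite_eq', hn1, if_true, pow_zero, one_mul, mul_one, h1, h2]
    rw [add_comm, TensorProduct.sum_tmul, TensorProduct.tmul_sum]
    simp only [TensorProduct.smul_tmul', TensorProduct.tmul_smul]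

end Eulerian

/-! ### Indecomposables -/

section Indecomposables

variable {H : Type*} [Ring H] [HopfAlgebra ℂ H] {𝒜 : ℕ → Submodule ℂ H}

/-- A finite free graded generating set, listed degree by degree. -/
theorem FreelyGenerates.exists_enumeration {X : ℕ+ → Set H} (hX : FreelyGenerates 𝒜 X)
    {a : ℕ+ → ℕ} (ha : ∀ n, (X n).encard = a n) :
    ∃ x : ∀ n, Fin (a n) → H, (∀ (n : ℕ+) i, x n i ∈ 𝒜 n) ∧
      IsFreeFamily fun p : Σ n, Fin (a n) => x p.1 p.2 := by
  have hequiv : ∀ n, Nonempty (Fin (a n) ≃ X n) := by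
    intro n
    have hfin : (X n).Finite := Set.finite_of_encard_eq_coe (ha n)
    have := hfin.to_subtype
    refine ⟨(Finite.equivFinOfCardEq ?_).symm⟩
    rw [Nat.card_coe_set_eq, Set.ncard, ha n, ENat.toNat_natCast]
  have e := fun n => (hequiv n).some
  refine ⟨fun n i => e n i, fun n i => hX.subset n (e n i).2, ?_⟩
  let E : (Σ n, Fin (a n)) ≃ Σ n, X n := Equiv.sigmaCongrRight e
  let F : FreeAlgebra ℂ (Σ n, Fin (a n)) ≃ₐ[ℂ] FreeAlgebra ℂ (Σ n, X n) :=
    AlgEquiv.ofAlgHom (FreeAlgebra.lift ℂ fun p => FreeAlgebra.ι ℂ (E p))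
      (FreeAlgebra.lift ℂ fun p => FreeAlgebra.ι ℂ (E.symm p))
      (by ext p; simp) (by ext p; simp)
  have hF : FreeAlgebra.lift ℂ (fun p : Σ n, Fin (a n) => (e p.1 p.2 : H)) =
      (FreeAlgebra.lift ℂ fun p : Σ n, X n => (p.2 : H)).comp F.toAlgHom := by
    ext p
    simp [F, E]
  rw [IsFreeFamily, hF]
  exact hX.free.comp F.bijective

theorem algHom_ext_of_surjective {A B : Type*} [Ring A] [Algebra ℂ A] [Ring B] [Algebra ℂ B]
    {ι : Type*} {x : ι → A} (hs : Function.Surjective (FreeAlgebra.lift ℂ x)) {φ ψ : A →ₐ[ℂ] B}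
    (h : ∀ i, φ (x i) = ψ (x i)) : φ = ψ := by
  have : φ.comp (FreeAlgebra.lift ℂ x) = ψ.comp (FreeAlgebra.lift ℂ x) := by
    ext i
    simpa using h i
  refine AlgHom.ext fun y => ?_
  obtain ⟨w, rfl⟩ := hs y
  exact DFunLike.congr_fun this w

/-- The space of indecomposables of degree `n`. -/
abbrev Indecomposables (𝒜 : ℕ → Submodule ℂ H) (n : ℕ) : Type _ :=
  𝒜 n ⧸ (decomposables 𝒜 n).submoduleOf (𝒜 n)

theorem span_mk_eq_top_iff {n : ℕ} {ι : Type*} (v : ι → 𝒜 n) :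
    Submodule.span ℂ (Set.range fun i => (Submodule.Quotient.mk (v i) : Indecomposables 𝒜 n)) = ⊤ ↔
      𝒜 n ≤ Submodule.span ℂ (Set.range fun i => (v i : H)) ⊔ decomposables 𝒜 n := by
  have h1 : Submodule.span ℂ
      (Set.range fun i => (Submodule.Quotient.mk (v i) : Indecomposables 𝒜 n)) =
      (Submodule.span ℂ (Set.range v)).map
        ((decomposables 𝒜 n).submoduleOf (𝒜 n)).mkQ := by
    rw [Submodule.map_span, ← Set.range_comp]
    rfl
  have h2 : Submodule.span ℂ (Set.range fun i => (v i : H)) =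
      (Submodule.span ℂ (Set.range v)).map (𝒜 n).subtype := by
    rw [Submodule.map_span, ← Set.range_comp]
    rfl
  rw [h1, h2]
  constructor
  · intro h y hy
    have : (((decomposables 𝒜 n).submoduleOf (𝒜 n)).mkQ ⟨y, hy⟩) ∈
        (⊤ : Submodule ℂ (Indecomposables 𝒜 n)) := trivial
    rw [← h] at this
    obtain ⟨w, hw, hwy⟩ := this
    have hmem : w - ⟨y, hy⟩ ∈ (decomposables 𝒜 n).submoduleOf (𝒜 n) :=
      (Submodule.Quotient.eq _).1 hwy
    have hmem' : (w : H) - y ∈ decomposables 𝒜 n := hmem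
    rw [show y = w - (w - y) by abel]
    exact sub_mem (Submodule.mem_sup_left ⟨w, hw, rfl⟩) (Submodule.mem_sup_right hmem')
  · intro h
    rw [eq_top_iff]
    rintro z -
    obtain ⟨y, rfl⟩ := Submodule.Quotient.mk_surjective _ z
    obtain ⟨_, ⟨w, hw, rfl⟩, d, hd, hwd⟩ := Submodule.mem_sup.1 (h y.2)
    refine ⟨w, hw, (Submodule.Quotient.eq _).2 ?_⟩
    change (w : H) - y ∈ decomposables 𝒜 n
    rw [← hwd]
    simpa using hd

/-- Free generators of degree `n` are linearly independent modulo decomposables. The coefficient of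
a generator is read off from the algebra homomorphism to the dual numbers which sends that generator
to `ε` and the others to `0`; it vanishes on products of elements of positive degree. -/
theorem linearIndependent_indecomposables
    (hε : ∀ n, n ≠ 0 → ∀ x ∈ 𝒜 n, Coalgebra.counit (R := ℂ) x = 0)
    {κ : ℕ+ → Type*} {x : ∀ n, κ n → H} (hx : ∀ (n : ℕ+) i, x n i ∈ 𝒜 n)
    (hfree : IsFreeFamily fun p : Σ n, κ n => x p.1 p.2) (n : ℕ+) :
    LinearIndependent ℂ fun i =>
      (Submodule.Quotient.mk ⟨x n i, hx n i⟩ : Indecomposables 𝒜 n) := by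
  classical
  let e := AlgEquiv.ofBijective _ hfree
  have he : ∀ p : Σ n, κ n, e.symm (x p.1 p.2) = FreeAlgebra.ι ℂ p := by
    intro p
    rw [AlgEquiv.symm_apply_eq]
    simp [e]
  let l : κ n → H →ₐ[ℂ] DualNumber ℂ := fun i =>
    (FreeAlgebra.lift ℂ fun p : Σ n, κ n => if p = ⟨n, i⟩ then DualNumber.eps else 0).comp
      e.symm.toAlgHom
  have hl : ∀ i (p : Σ n, κ n), l i (x p.1 p.2) = if p = ⟨n, i⟩ then DualNumber.eps else 0 := by
    intro i p
    simp [l, he]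
  have hfst : ∀ i, (TrivSqZeroExt.fstHom ℂ ℂ ℂ).comp (l i) = Bialgebra.counitAlgHom ℂ H := by
    intro i
    refine algHom_ext_of_surjective hfree.2 fun p => ?_
    rw [AlgHom.comp_apply, hl, Bialgebra.counitAlgHom_apply, hε _ p.1.ne_zero _ (hx p.1 p.2)]
    split_ifs <;> simp
  have hfst' : ∀ i m, m ≠ 0 → ∀ y ∈ 𝒜 m, (l i y).fst = 0 := by
    intro i m hm y hy
    have := DFunLike.congr_fun (hfst i) y
    rw [Bialgebra.counitAlgHom_apply, hε m hm y hy] at this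
    exact this
  let c : κ n → H →ₗ[ℂ] ℂ := fun i => TrivSqZeroExt.sndHom ℂ ℂ ∘ₗ (l i).toLinearMap
  have hcD : ∀ i, decomposables 𝒜 n ≤ LinearMap.ker (c i) := by
    intro i
    refine decomposables_le_iff.2 fun j k _ hj hk u hu v hv => ?_
    change (l i (u * v)).snd = 0
    rw [map_mul, TrivSqZeroExt.snd_mul, hfst' i j hj u hu, hfst' i k hk v hv]
    simp
  have hcx : ∀ i j, c i (x n j) = if j = i then 1 else 0 := by
    intro i j
    change (l i (x n j)).snd = _
    rw [hl i ⟨n, j⟩]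
    by_cases h : j = i <;> simp [h]
  let q : κ n → Indecomposables 𝒜 n →ₗ[ℂ] ℂ := fun i =>
    Submodule.liftQ _ (c i ∘ₗ (𝒜 n).subtype) fun y hy => hcD i hy
  have hq : ∀ i j, q i (Submodule.Quotient.mk ⟨x n j, hx n j⟩) = if j = i then 1 else 0 := hcx
  rw [linearIndependent_iff']
  intro s g hg i hi
  have := congrArg (q i) hg
  simpa [map_sum, hq, hi] using this

theorem exists_basis_indecomposables [GradedAlgebra 𝒜]
    (hε : ∀ n, n ≠ 0 → ∀ x ∈ 𝒜 n, Coalgebra.counit (R := ℂ) x = 0)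
    {a : ℕ+ → ℕ} {x : ∀ n, Fin (a n) → H} (hx : ∀ (n : ℕ+) i, x n i ∈ 𝒜 n)
    (hfree : IsFreeFamily fun p : Σ n, Fin (a n) => x p.1 p.2) (n : ℕ+) :
    Nonempty (Module.Basis (Fin (a n)) ℂ (Indecomposables 𝒜 n)) :=
  ⟨Module.Basis.mk (linearIndependent_indecomposables hε hx hfree n)
    ((span_mk_eq_top_iff fun i => (⟨x n i, hx n i⟩ : 𝒜 n)).2
      (graded_le_span_sup hx hfree.2 n)).ge⟩

end Indecomposables

/-! ### Spanning families and surjections -/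

section LinearAlgebra

/-- A surjective linear map admits spanning families of the sizes of given bases such that the
first members of the one are mapped to the other. -/
theorem exists_spanning_families {V U : Type*} [AddCommGroup V] [Module ℂ V] [AddCommGroup U]
    [Module ℂ U] {a b : ℕ} (bV : Module.Basis (Fin a) ℂ V) (bU : Module.Basis (Fin b) ℂ U)
    {T : V →ₗ[ℂ] U} (hT : Function.Surjective T) :
    ∃ (h : b ≤ a) (v : Fin a → V), Submodule.span ℂ (Set.range v) = ⊤ ∧
      Submodule.span ℂ (Set.range fun i : Fin b => T (v (Fin.castLE h i))) = ⊤ := by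
  have : Module.Finite ℂ V := Module.Finite.of_basis bV
  have hV : Module.finrank ℂ V = a := by simp [Module.finrank_eq_card_basis bV]
  have hU : Module.finrank ℂ U = b := by simp [Module.finrank_eq_card_basis bU]
  have hrank := LinearMap.finrank_range_add_finrank_ker T
  rw [LinearMap.range_eq_top.2 hT, finrank_top, hV, hU] at hrank
  obtain ⟨c, hc⟩ : ∃ c, c = Module.finrank ℂ (LinearMap.ker T) := ⟨_, rfl⟩
  let k := (Module.finBasisOfFinrankEq ℂ (LinearMap.ker T) hc.symm)
  rw [← hc] at hrank
  subst hrank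
  obtain ⟨s, hs⟩ := T.exists_rightInverse_of_surjective (LinearMap.range_eq_top.2 hT)
  have hs' : ∀ u, T (s u) = u := fun u => LinearMap.congr_fun hs u
  refine ⟨Nat.le_add_right b c, Fin.append (fun i => s (bU i)) (fun j => (k j : V)), ?_, ?_⟩
  · rw [eq_top_iff]
    rintro z -
    set M := Submodule.span ℂ (Set.range (Fin.append (fun i => s (bU i)) fun j => (k j : V)))
    have h1 : ∀ u, s u ∈ M := by
      have : (⊤ : Submodule ℂ U) ≤ M.comap s := by
        rw [← bU.span_eq, Submodule.span_le]
        rintro _ ⟨i, rfl⟩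
        exact Submodule.subset_span ⟨Fin.castAdd c i, by simp⟩
      exact fun u => this trivial
    have h2 : ∀ w : LinearMap.ker T, (w : V) ∈ M := by
      have : (⊤ : Submodule ℂ (LinearMap.ker T)) ≤ M.comap (LinearMap.ker T).subtype := by
        rw [← k.span_eq, Submodule.span_le]
        rintro _ ⟨i, rfl⟩
        exact Submodule.subset_span ⟨Fin.natAdd b i, by simp⟩
      exact fun w => this (x := w) trivial
    have h3 : z - s (T z) ∈ LinearMap.ker T := by simp [hs']
    simpa using add_mem (h2 ⟨_, h3⟩) (h1 (T z))
  · convert bU.span_eq using 3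
    ext i
    change T (Fin.append _ _ (Fin.castAdd c i)) = _
    rw [Fin.append_left, hs']

end LinearAlgebra

/-! ### Primitive elements and primitive generating sets -/

section Primitive

variable {H : Type*} [Ring H] [HopfAlgebra ℂ H] {K : Type*} [Ring K] [HopfAlgebra ℂ K]
variable {𝒜 : ℕ → Submodule ℂ H} {ℬ : ℕ → Submodule ℂ K} {a b : ℕ+ → ℕ}

theorem IsPrimitiveElement.sub {x y : H} (hx : IsPrimitiveElement x) (hy : IsPrimitiveElement y) :
    IsPrimitiveElement (x - y) := by
  rw [IsPrimitiveElement] at *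
  rw [map_sub, hx, hy, TensorProduct.sub_tmul, TensorProduct.tmul_sub]
  abel

theorem IsPrimitiveElement.smul {x : H} (hx : IsPrimitiveElement x) (c : ℂ) :
    IsPrimitiveElement (c • x) := by
  rw [IsPrimitiveElement] at *
  rw [map_smul, hx, smul_add, TensorProduct.smul_tmul', TensorProduct.tmul_smul]

theorem IsPrimitiveElement.map {φ : H →ₐ[ℂ] K}
    (hφ : (Algebra.TensorProduct.map φ φ).comp (Bialgebra.comulAlgHom ℂ H) =
      (Bialgebra.comulAlgHom ℂ K).comp φ) {x : H} (hx : IsPrimitiveElement x) :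
    IsPrimitiveElement (φ x) := by
  have h := DFunLike.congr_fun hφ x
  rw [IsPrimitiveElement] at *
  simp only [AlgHom.comp_apply, Bialgebra.comulAlgHom_apply] at h
  rw [← h, hx]
  simp

/-- An algebra homomorphism sending primitive generators to primitive elements respects the
comultiplications. -/
theorem map_comp_comul_of_primitive {ι : Type*} {x : ι → H}
    (hs : Function.Surjective (FreeAlgebra.lift ℂ x)) (hx : ∀ i, IsPrimitiveElement (x i))
    (φ : H →ₐ[ℂ] K) (hφ : ∀ i, IsPrimitiveElement (φ (x i))) :
    (Algebra.TensorProduct.map φ φ).comp (Bialgebra.comulAlgHom ℂ H) =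
      (Bialgebra.comulAlgHom ℂ K).comp φ := by
  refine algHom_ext_of_surjective hs fun i => ?_
  have h1 := hx i
  have h2 := hφ i
  rw [IsPrimitiveElement] at h1 h2
  simp only [AlgHom.comp_apply, Bialgebra.comulAlgHom_apply]
  rw [h1, h2]
  simp

theorem le_span_sup_of_sub_mem {D M : Submodule ℂ H} {ι : Type*} {v w : ι → H}
    (hvw : ∀ i, v i - w i ∈ Submodule.span ℂ (Set.range w) ⊔ D)
    (h : M ≤ Submodule.span ℂ (Set.range v) ⊔ D) : M ≤ Submodule.span ℂ (Set.range w) ⊔ D := by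
  refine h.trans (sup_le (Submodule.span_le.2 ?_) le_sup_right)
  rintro _ ⟨i, rfl⟩
  rw [← sub_add_cancel (v i) (w i)]
  exact add_mem (hvw i) (Submodule.mem_sup_left (Submodule.subset_span ⟨i, rfl⟩))

/-- Homogeneous primitive elements, as many in each degree as there are free generators, form an
ordered primitive generating set when they span modulo decomposables. -/
def OPG.ofSpan [GradedAlgebra 𝒜] {x : ∀ n, Fin (a n) → H} (hx : ∀ (n : ℕ+) i, x n i ∈ 𝒜 n)
    (hfree : IsFreeFamily fun p : Σ n, Fin (a n) => x p.1 p.2) (y : ∀ n, Fin (a n) → H)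
    (hy : ∀ (n : ℕ+) i, y n i ∈ 𝒜 n) (hp : ∀ n i, IsPrimitiveElement (y n i))
    (h : ∀ n : ℕ+, 𝒜 n ≤ Submodule.span ℂ (Set.range (y n)) ⊔ decomposables 𝒜 n) : OPG 𝒜 a where
  elem := y
  mem := hy
  primitive := hp
  free := free_of_graded_le hx hfree hy h

/-- Multiplication of all members of an ordered primitive generating set by a nonzero scalar. -/
def OPG.scale [GradedAlgebra 𝒜] (A : OPG 𝒜 a) {c : ℂ} (hc : c ≠ 0) : OPG 𝒜 a :=
  OPG.ofSpan A.mem A.free (fun n i => c • A.elem n i)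
    (fun n i => Submodule.smul_mem _ _ (A.mem n i)) (fun n i => (A.primitive n i).smul c)
    fun n => by
      refine le_span_sup_of_sub_mem (fun i => Submodule.mem_sup_left ?_)
        (graded_le_span_sup A.mem A.free.2 n)
      have h : c • A.elem n i ∈ Submodule.span ℂ (Set.range fun i => c • A.elem n i) :=
        Submodule.subset_span ⟨i, rfl⟩
      refine sub_mem ?_ h
      simpa [smul_smul, hc] using Submodule.smul_mem _ c⁻¹ h

theorem OPG.elem_ne_zero (A : OPG 𝒜 a) (n : ℕ+) (i : Fin (a n)) : A.elem n i ≠ 0 := by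
  intro h
  refine FreeAlgebra.ι_ne_zero (R := ℂ) (⟨n, i⟩ : Σ n, Fin (a n)) (A.free.1 ?_)
  simpa using h

theorem projection_scale [GradedAlgebra 𝒜] [GradedAlgebra ℬ] (A : OPG 𝒜 a) (B : OPG ℬ b) {c : ℂ}
    (hc : c ≠ 0) : projection (A.scale hc) (B.scale hc) = projection A B := by
  refine algHom_ext_of_surjective (A.scale hc).free.2 fun p => ?_
  rw [projection_elem]
  change _ = projection A B (c • A.elem p.1 p.2)
  rw [map_smul, projection_elem]
  split_ifs
  · rfl
  · simp

/-- The coordinate projection as a homomorphism of graded Hopf algebras. -/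
def projectionHom [GradedAlgebra 𝒜] [GradedAlgebra ℬ] (h𝒜 : IsGradedHopf 𝒜) (hℬ : IsGradedHopf ℬ)
    (A : OPG 𝒜 a) (B : OPG ℬ b) : GradedHopfHom 𝒜 ℬ where
  toBialgHom := .ofAlgHom (projection A B)
    (algHom_ext_of_surjective A.free.2 fun p => by
      have h1 := h𝒜.counit_eq_zero _ p.1.ne_zero _ (A.mem p.1 p.2)
      simp only [AlgHom.comp_apply, Bialgebra.counitAlgHom_apply]
      rw [projection_elem, h1]
      split_ifs with h
      · exact hℬ.counit_eq_zero _ p.1.ne_zero _ (B.mem p.1 ⟨p.2, h⟩)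
      · exact map_zero _)
    (map_comp_comul_of_primitive A.free.2 (fun p => A.primitive p.1 p.2) _ fun p => by
      rw [projection_elem]
      split_ifs with h
      · exact B.primitive _ _
      · simp [IsPrimitiveElement])
  map_mem := map_mem_of_generators (graded_zero_le_one A.mem A.free.2)
    (graded_le_span_sup A.mem A.free.2) (projection A B) fun n i => by
      rw [projection_elem]
      split_ifs with h
      · exact B.mem n ⟨i, h⟩
      · exact zero_mem _

theorem projection_surjective (A : OPG 𝒜 a) (B : OPG ℬ b) (hba : b ≤ a) :
    Function.Surjective (projection A B) := by
  intro z
  obtain ⟨w, rfl⟩ := B.free.2 z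
  change _ ∈ (projection A B).range
  induction w using FreeAlgebra.induction with
  | grade0 r => exact ⟨algebraMap ℂ H r, by simp⟩
  | grade1 p =>
    refine ⟨A.elem p.1 (Fin.castLE (hba p.1) p.2), ?_⟩
    change projection A B _ = _
    rw [projection_elem]
    simp
  | mul u v hu hv => rw [map_mul]; exact mul_mem hu hv
  | add u v hu hv => rw [map_add]; exact add_mem hu hv

end Primitive

/-! ### Surjective homomorphisms -/

section Surjections

variable {H : Type*} [Ring H] [HopfAlgebra ℂ H] {K : Type*} [Ring K] [HopfAlgebra ℂ K]
variable {𝒜 : ℕ → Submodule ℂ H} {ℬ : ℕ → Submodule ℂ K} [GradedAlgebra 𝒜] [GradedAlgebra ℬ]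
  {a b : ℕ+ → ℕ}

/-- For a surjective homomorphism, homogeneous primitive elements of degree `n` spanning modulo
decomposables can be chosen so that the images of the first `b n` of them do so too. -/
theorem exists_primitive_spanning (hH : IsGradedHopf 𝒜) (hHc : Coalgebra.IsCocomm ℂ H)
    (hK : IsGradedHopf ℬ) {x : ∀ n, Fin (a n) → H} (hx : ∀ (n : ℕ+) i, x n i ∈ 𝒜 n)
    (hxfree : IsFreeFamily fun p : Σ n, Fin (a n) => x p.1 p.2)
    {y : ∀ n, Fin (b n) → K} (hy : ∀ (n : ℕ+) i, y n i ∈ ℬ n)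
    (hyfree : IsFreeFamily fun p : Σ n, Fin (b n) => y p.1 p.2)
    (f : GradedHopfHom 𝒜 ℬ) (hf : Function.Surjective f.toBialgHom) (n : ℕ+) :
    ∃ (h : b n ≤ a n) (p : Fin (a n) → H), (∀ i, p i ∈ 𝒜 n) ∧ (∀ i, IsPrimitiveElement (p i)) ∧
      𝒜 n ≤ Submodule.span ℂ (Set.range p) ⊔ decomposables 𝒜 n ∧
      ℬ n ≤ Submodule.span ℂ (Set.range fun i : Fin (b n) => f.toBialgHom (p (Fin.castLE h i))) ⊔
        decomposables ℬ n := by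
  obtain ⟨bV⟩ := exists_basis_indecomposables hH.counit_eq_zero hx hxfree n
  obtain ⟨bU⟩ := exists_basis_indecomposables hK.counit_eq_zero hy hyfree n
  let φ : H →ₐ[ℂ] K := f.toBialgHom
  have hφ : ∀ m, ∀ z ∈ 𝒜 m, φ z ∈ ℬ m := f.map_mem
  let r : 𝒜 n →ₗ[ℂ] ℬ n := φ.toLinearMap.restrict (hφ n)
  have hr : Function.Surjective r := by
    intro z
    obtain ⟨w, hw⟩ := hf z
    have hw' : φ w = z := hw
    refine ⟨DirectSum.decompose 𝒜 w n, Subtype.ext ?_⟩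
    change φ (DirectSum.decompose 𝒜 w n : H) = z
    rw [← decompose_map φ hφ, hw', DirectSum.decompose_of_mem_same ℬ z.2]
  let T : Indecomposables 𝒜 n →ₗ[ℂ] Indecomposables ℬ n :=
    Submodule.mapQ _ _ r fun z hz => map_mem_decomposables φ hφ hz
  have hT : Function.Surjective T := by
    intro z
    obtain ⟨z, rfl⟩ := Submodule.Quotient.mk_surjective _ z
    obtain ⟨w, rfl⟩ := hr z
    exact ⟨Submodule.Quotient.mk w, rfl⟩
  obtain ⟨h, v, hv, hTv⟩ := exists_spanning_families bV bU hT
  choose w hw using fun i => Submodule.Quotient.mk_surjective _ (v i)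
  obtain rfl : (fun i => Submodule.Quotient.mk (w i)) = v := funext hw
  rw [span_mk_eq_top_iff] at hv
  have hTv' : ℬ n ≤ Submodule.span ℂ (Set.range fun i : Fin (b n) =>
      φ (w (Fin.castLE h i))) ⊔ decomposables ℬ n :=
    (span_mk_eq_top_iff fun i : Fin (b n) => r (w (Fin.castLE h i))).1 hTv
  choose p hp hprim hwp using fun i => exists_primitive_sub_mem_decomposables hH hHc
    (graded_zero_le_one hx hxfree.2) n.ne_zero (w i).2
  refine ⟨h, p, hp, hprim, le_span_sup_of_sub_mem (fun i => Submodule.mem_sup_right (hwp i)) hv,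
    le_span_sup_of_sub_mem (fun i => Submodule.mem_sup_right ?_) hTv'⟩
  have := map_mem_decomposables φ hφ (hwp (Fin.castLE h i))
  rwa [map_sub] at this

/-- Every surjective homomorphism is a coordinate projection. Primitive elements of `H` lifting
generators of `K` determine a section `s` of `f`, and subtracting `s (f p)` from the remaining
primitive generators `p` moves them into the kernel of `f`. -/
theorem exists_eq_projection (hH : IsGradedHopf 𝒜) (hHc : Coalgebra.IsCocomm ℂ H)
    (hK : IsGradedHopf ℬ) {x : ∀ n, Fin (a n) → H} (hx : ∀ (n : ℕ+) i, x n i ∈ 𝒜 n)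
    (hxfree : IsFreeFamily fun p : Σ n, Fin (a n) => x p.1 p.2)
    {y : ∀ n, Fin (b n) → K} (hy : ∀ (n : ℕ+) i, y n i ∈ ℬ n)
    (hyfree : IsFreeFamily fun p : Σ n, Fin (b n) => y p.1 p.2)
    (f : GradedHopfHom 𝒜 ℬ) (hf : Function.Surjective f.toBialgHom) :
    ∃ (A : OPG 𝒜 a) (B : OPG ℬ b), (f.toBialgHom : H →ₐ[ℂ] K) = projection A B := by
  choose h p hp hprim hspan hfspan using
    exists_primitive_spanning hH hHc hK hx hxfree hy hyfree f hf
  set φ : H →ₐ[ℂ] K := (f.toBialgHom : H →ₐ[ℂ] K)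
  have hφ : ∀ m, ∀ z ∈ 𝒜 m, φ z ∈ ℬ m := f.map_mem
  have hφΔ : (Algebra.TensorProduct.map φ φ).comp (Bialgebra.comulAlgHom ℂ H) =
      (Bialgebra.comulAlgHom ℂ K).comp φ := BialgHomClass.map_comp_comulAlgHom f.toBialgHom
  let B : OPG ℬ b := OPG.ofSpan hy hyfree (fun n i => φ (p n (Fin.castLE (h n) i)))
    (fun n i => hφ n _ (hp n _)) (fun n i => (hprim n _).map hφΔ) hfspan
  let s : K →ₐ[ℂ] H := (FreeAlgebra.lift ℂ fun q : Σ n, Fin (b n) =>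
    p q.1 (Fin.castLE (h q.1) q.2)).comp (AlgEquiv.ofBijective _ B.free).symm.toAlgHom
  have hsB : ∀ n i, s (B.elem n i) = p n (Fin.castLE (h n) i) := by
    intro n i
    have h1 : (AlgEquiv.ofBijective _ B.free).symm (B.elem n i) =
        FreeAlgebra.ι ℂ (⟨n, i⟩ : Σ n, Fin (b n)) := by
      rw [AlgEquiv.symm_apply_eq]
      simp
    simp [s, h1]
  have hs : ∀ m, ∀ z ∈ ℬ m, s z ∈ 𝒜 m :=
    map_mem_of_generators (graded_zero_le_one B.mem B.free.2) (graded_le_span_sup B.mem B.free.2) s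
      fun n i => (hsB n i).symm ▸ hp n _
  have hsΔ := map_comp_comul_of_primitive B.free.2 (fun q => B.primitive q.1 q.2) s
    fun q => (hsB q.1 q.2).symm ▸ hprim q.1 _
  have hφs : ∀ z, φ (s z) = z := by
    have : φ.comp s = AlgHom.id ℂ K := algHom_ext_of_surjective B.free.2 fun q => by
      rw [AlgHom.comp_apply, hsB]
      rfl
    exact DFunLike.congr_fun this
  let α : ∀ n, Fin (a n) → H := fun n i => if (i : ℕ) < b n then p n i else p n i - s (φ (p n i))
  have hα : ∀ n i, IsPrimitiveElement (α n i) := by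
    intro n i
    simp only [α]
    split_ifs
    · exact hprim n i
    · exact (hprim n i).sub (((hprim n i).map hφΔ).map hsΔ)
  have hαmem : ∀ (n : ℕ+) i, α n i ∈ 𝒜 n := by
    intro n i
    simp only [α]
    split_ifs
    · exact hp n i
    · exact sub_mem (hp n i) (hs n _ (hφ n _ (hp n i)))
  have hsα : ∀ n : ℕ+, ∀ z ∈ ℬ n,
      s z ∈ Submodule.span ℂ (Set.range (α n)) ⊔ decomposables 𝒜 n := by
    intro n
    suffices ℬ n ≤ (Submodule.span ℂ (Set.range (α n)) ⊔ decomposables 𝒜 n).comap s.toLinearMap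
      from this
    refine (graded_le_span_sup B.mem B.free.2 n).trans (sup_le (Submodule.span_le.2 ?_) ?_)
    · rintro _ ⟨i, rfl⟩
      change s (B.elem n i) ∈ Submodule.span ℂ (Set.range (α n)) ⊔ decomposables 𝒜 n
      rw [hsB]
      refine Submodule.mem_sup_left (Submodule.subset_span ⟨Fin.castLE (h n) i, ?_⟩)
      simp [α]
    · exact fun z hz => Submodule.mem_sup_right (map_mem_decomposables s hs hz)
  let A : OPG 𝒜 a := OPG.ofSpan hx hxfree α hαmem hα fun n => by
    refine le_span_sup_of_sub_mem (fun i => ?_) (hspan n)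
    by_cases hi : (i : ℕ) < b n
    · simp [α, hi]
    · simpa [α, hi] using hsα n _ (hφ n _ (hp n i))
  refine ⟨A, B, algHom_ext_of_surjective A.free.2 fun q => ?_⟩
  rw [projection_elem]
  change φ (α q.1 q.2) = _
  by_cases hi : (q.2 : ℕ) < b q.1
  · simp only [α, hi, if_true, dif_pos]
    rfl
  · simp only [α, hi, if_false, dif_neg, not_false_eq_true]
    rw [map_sub, hφs, sub_self]

theorem le_of_surjective (hH : IsGradedHopf 𝒜) (hHc : Coalgebra.IsCocomm ℂ H)
    (hK : IsGradedHopf ℬ) {x : ∀ n, Fin (a n) → H} (hx : ∀ (n : ℕ+) i, x n i ∈ 𝒜 n)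
    (hxfree : IsFreeFamily fun p : Σ n, Fin (a n) => x p.1 p.2)
    {y : ∀ n, Fin (b n) → K} (hy : ∀ (n : ℕ+) i, y n i ∈ ℬ n)
    (hyfree : IsFreeFamily fun p : Σ n, Fin (b n) => y p.1 p.2)
    (f : GradedHopfHom 𝒜 ℬ) (hf : Function.Surjective f.toBialgHom) : b ≤ a := fun n =>
  (exists_primitive_spanning hH hHc hK hx hxfree hy hyfree f hf n).1

/-- Ordered primitive generating sets exist: the identity is a coordinate projection. -/
theorem nonempty_OPG (hH : IsGradedHopf 𝒜) (hHc : Coalgebra.IsCocomm ℂ H)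
    {x : ∀ n, Fin (a n) → H} (hx : ∀ (n : ℕ+) i, x n i ∈ 𝒜 n)
    (hxfree : IsFreeFamily fun p : Σ n, Fin (a n) => x p.1 p.2) : Nonempty (OPG 𝒜 a) := by
  obtain ⟨A, -, -⟩ := exists_eq_projection hH hHc hH hx hxfree hx hxfree
    { toBialgHom := BialgHom.id ℂ H, map_mem := fun _ _ h => h } Function.surjective_id
  exact ⟨A⟩

end Surjections

end FGCCHA

end

theorem mainTheorem3
    {H : Type*} [Ring H] [HopfAlgebra ℂ H] (𝒜 : ℕ → Submodule ℂ H) [GradedAlgebra 𝒜]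
    {K : Type*} [Ring K] [HopfAlgebra ℂ K] (ℬ : ℕ → Submodule ℂ K) [GradedAlgebra ℬ]
    (hH : FGCCHA.IsFGCCHA 𝒜) (hK : FGCCHA.IsFGCCHA ℬ)
    (a b : ℕ+ → ℕ)
    (X : ℕ+ → Set H) (hX : FGCCHA.FreelyGenerates 𝒜 X) (ha : ∀ n, (X n).encard = a n)
    (Y : ℕ+ → Set K) (hY : FGCCHA.FreelyGenerates ℬ Y) (hb : ∀ n, (Y n).encard = b n) :
    ((∃ f : FGCCHA.GradedHopfHom 𝒜 ℬ, Function.Surjective f.toBialgHom) ↔ b ≤ a) ∧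
    (∀ f : FGCCHA.GradedHopfHom 𝒜 ℬ, Function.Surjective f.toBialgHom →
      {P : FGCCHA.OPG 𝒜 a × FGCCHA.OPG ℬ b |
        (f.toBialgHom : H →ₐ[ℂ] K) = FGCCHA.projection P.1 P.2}.Nonempty ∧
      (a ≠ 0 → {P : FGCCHA.OPG 𝒜 a × FGCCHA.OPG ℬ b |
        (f.toBialgHom : H →ₐ[ℂ] K) = FGCCHA.projection P.1 P.2}.Nontrivial)) := by
  obtain ⟨x, hx, hxfree⟩ := hX.exists_enumeration ha
  obtain ⟨y, hy, hyfree⟩ := hY.exists_enumeration hb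
  refine ⟨⟨fun ⟨f, hf⟩ => FGCCHA.le_of_surjective hH.graded hH.cocomm hK.graded hx hxfree hy hyfree
    f hf, fun hba => ?_⟩, fun f hf => ?_⟩
  · obtain ⟨A⟩ := FGCCHA.nonempty_OPG hH.graded hH.cocomm hx hxfree
    obtain ⟨B⟩ := FGCCHA.nonempty_OPG hK.graded hK.cocomm hy hyfree
    exact ⟨FGCCHA.projectionHom hH.graded hK.graded A B, FGCCHA.projection_surjective A B hba⟩
  · obtain ⟨A, B, hAB⟩ :=
      FGCCHA.exists_eq_projection hH.graded hH.cocomm hK.graded hx hxfree hy hyfree f hf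
    refine ⟨⟨(A, B), hAB⟩, fun ha0 => ?_⟩
    obtain ⟨n, hn⟩ := Function.ne_iff.1 ha0
    -- a second pair is obtained by doubling the members of both generating sets
    refine ⟨(A, B), hAB, (A.scale two_ne_zero, B.scale two_ne_zero),
      hAB.trans (FGCCHA.projection_scale A B two_ne_zero).symm, fun h => ?_⟩
    let i : Fin (a n) := ⟨0, Nat.pos_of_ne_zero hn⟩
    have h2 : A.elem n i = (2 : ℂ) • A.elem n i :=
      congrArg (fun P : FGCCHA.OPG 𝒜 a × FGCCHA.OPG ℬ b => P.1.elem n i) h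
    rw [two_smul, left_eq_add] at h2
    exact A.elem_ne_zero n i h2
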